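/- Let $D\ge 2$ be a squarefree integer, let $K=\mathbb{Q}(\sqrt D)$, let $\mathcal O$ be the ring of integers of $K$, and let $\mathcal O^+$ be the set of totally positive elements of $\mathcal O$, i.e. of those $\alpha\in\mathcal O$ with $\sigma(\alpha)>0$ for every embedding $\sigma:K\hookrightarrow\mathbb R$. Let $\kappa=1$ if $D\equiv 1\pmod 4$ and $\kappa=2$ if $D\equiv 2,3\pmod 4$. Let $m$ be a positive integer. (a) If $m<\frac{\kappa\sqrt D}{4}$, then not all elements of $m\mathcal O^+$ are sums of squares of elements of $\mathcal O$. (b) If $m\ge \frac D2$, then every element of $\kappa m\mathcal O^+$ is a sum of five squares of elements of $\mathcal O$ (where some of the squares may be $0$). (c) If $m$ is odd and $D\equiv 2,3\pmod 4$, then there exist elements of $m\mathcal O^+$ that are not sums of squares of elements of $\mathcal O$. -/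

import Mathlib

open NumberField

/-- The real quadratic field `ℚ(√D)`, as a subfield of `ℝ`. -/
noncomputable abbrev QSqrt (D : ℕ) : IntermediateField ℚ ℝ :=
  IntermediateField.adjoin ℚ {Real.sqrt (D : ℝ)}

/-- For a totally real field `K`, the set `𝓞⁺` of totally positive elements of its ring of
integers: those whose image under every embedding `K ↪ ℝ` is positive. -/
def totallyPositiveIntegers (K : Type*) [Field K] : Set (𝓞 K) :=
  {α | ∀ σ : K →+* ℝ, 0 < σ (α : K)}

/-- `κ = 1` if `D ≡ 1 (mod 4)`, and `κ = 2` otherwise (that is, if `D ≡ 2, 3 (mod 4)` when `D` is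
squarefree). -/
def kappa (D : ℕ) : ℕ := if D % 4 = 1 then 1 else 2

/-- `a` is a sum of five squares (zero summands allowed) of elements of `R`. -/
def IsSumOfFiveSquares {R : Type*} [CommRing R] (a : R) : Prop :=
  ∃ x : Fin 5 → R, a = ∑ i, x i ^ 2

/-! Every element of `𝓞 (QSqrt D)` is `κ (u + v √D) / 2` with integers `u`, `v` (of equal parity if
`κ = 1`), and it is totally positive exactly when `u > 0` and `D v² < u²`. Summing squares of such
elements gives `κ² (A + D C + 2 B √D) / 4`, where `A, B, C` are the Gram entries of the two
coordinate vectors.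

For (a) and (c), take `α = κ (w + √D) / 2`. If `m α` is a sum of squares, then `m = κ B`, which
excludes odd `m` when `κ = 2`. Moreover `B ≠ 0` forces `C ≥ 1`, so `κ D ≤ 2 m w`; with `w` just
above `√D` this contradicts the bound on `m` in (a).

For (b), write `κ m α = A + 2 B t + C t²` with `t = √D` or `t = (1 + √D) / 2`. One integer parameter
is free. A semidefinite choice exists once a multiple of `D` (or of `2 D`) can be placed near enough
to a given integer, and `m ≥ D / 2` ensures this. Mordell's theorem
(`isSumFiveSqLinearForms_of_nonneg`) then gives five squares.

Mordell's theorem is reduced to three squares: subtract the square of a suitable linear form so that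
the remaining determinant is a sum of three squares, then factor a quaternion to write the remainder
as four squares. Legendre's theorem comes from Dirichlet's theorem, reciprocity and reduction of
ternary forms of determinant one. -/

theorem Int.exists_mul_add_two_mul_le (a x : ℤ) (ha : 0 < a) :
    ∃ k r : ℤ, x = a * k + r ∧ -a ≤ 2 * r ∧ 2 * r < a := by
  refine ⟨(2 * x + a) / (2 * a), x - a * ((2 * x + a) / (2 * a)), by ring, ?_, ?_⟩
  · have := Int.mul_ediv_self_le (x := 2 * x + a) (k := 2 * a) (by omega)
    nlinarith
  · have := Int.lt_mul_ediv_self_add (x := 2 * x + a) (k := 2 * a) (by omega)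
    nlinarith

/-! ### Factorization of Lipschitz quaternions. -/

namespace Quaternion

/-- The Lipschitz quaternion with the given coordinates. -/
def ofCoords (a b c d : ℤ) : Quaternion ℤ := ⟨a, b, c, d⟩

@[simp] theorem re_ofCoords (a b c d : ℤ) : (ofCoords a b c d).re = a := rfl

@[simp] theorem imI_ofCoords (a b c d : ℤ) : (ofCoords a b c d).imI = b := rfl

@[simp] theorem imJ_ofCoords (a b c d : ℤ) : (ofCoords a b c d).imJ = c := rfl

@[simp] theorem imK_ofCoords (a b c d : ℤ) : (ofCoords a b c d).imK = d := rfl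

theorem normSq_ofCoords (a b c d : ℤ) :
    normSq (ofCoords a b c d) = a ^ 2 + b ^ 2 + c ^ 2 + d ^ 2 := normSq_def' _

theorem exists_normSq_eq_natCast (n : ℕ) : ∃ q : Quaternion ℤ, normSq q = n := by
  obtain ⟨a, b, c, d, h⟩ := Nat.sum_four_squares n
  refine ⟨ofCoords a b c d, ?_⟩
  rw [normSq_ofCoords, ← h]
  push_cast
  ring

/-- A Lipschitz quaternion whose norm is `a * c` is a product of Lipschitz quaternions of
norms `a` and `c`. -/
theorem exists_eq_mul_of_normSq_eq_mul (a : ℕ) : ∀ (c : ℕ) (q : Quaternion ℤ),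
    normSq q = (a : ℤ) * c →
      ∃ d e : Quaternion ℤ, q = d * e ∧ normSq d = (a : ℤ) ∧ normSq e = (c : ℤ) := by
  induction a using Nat.strong_induction_on with
  | _ a ih =>
  intro c q hq
  rcases Nat.eq_zero_or_pos a with rfl | ha
  · obtain ⟨e, he⟩ := exists_normSq_eq_natCast c
    refine ⟨0, e, ?_, by simp, he⟩
    have : normSq q = 0 := by simpa using hq
    simpa using normSq_eq_zero.1 this
  have ha' : (0 : ℤ) < a := by exact_mod_cast ha
  obtain ⟨k₁, r₁, h₁, l₁, u₁⟩ := Int.exists_mul_add_two_mul_le a q.re ha'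
  obtain ⟨k₂, r₂, h₂, l₂, u₂⟩ := Int.exists_mul_add_two_mul_le a q.imI ha'
  obtain ⟨k₃, r₃, h₃, l₃, u₃⟩ := Int.exists_mul_add_two_mul_le a q.imJ ha'
  obtain ⟨k₄, r₄, h₄, l₄, u₄⟩ := Int.exists_mul_add_two_mul_le a q.imK ha'
  set k := ofCoords k₁ k₂ k₃ k₄ with hk
  set r := ofCoords r₁ r₂ r₃ r₄ with hr
  have hqr : q = r + (a : Quaternion ℤ) * k := by
    ext <;> simp [hk, hr, h₁, h₂, h₃, h₄, add_comm]
  have hr2 : normSq r = r₁ ^ 2 + r₂ ^ 2 + r₃ ^ 2 + r₄ ^ 2 := normSq_ofCoords ..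
  have s₁ : 4 * r₁ ^ 2 ≤ (a : ℤ) ^ 2 := by nlinarith
  have s₂ : 4 * r₂ ^ 2 ≤ (a : ℤ) ^ 2 := by nlinarith
  have s₃ : 4 * r₃ ^ 2 ≤ (a : ℤ) ^ 2 := by nlinarith
  have s₄ : 4 * r₄ ^ 2 ≤ (a : ℤ) ^ 2 := by nlinarith
  obtain ⟨c', hc'⟩ : ∃ c' : ℤ, normSq r = a * c' := by
    refine ⟨c - 2 * (k₁ * r₁ + k₂ * r₂ + k₃ * r₃ + k₄ * r₄)
      - a * (k₁ ^ 2 + k₂ ^ 2 + k₃ ^ 2 + k₄ ^ 2), ?_⟩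
    rw [normSq_def', h₁, h₂, h₃, h₄] at hq
    rw [hr2]
    linear_combination hq
  have hc0 : 0 ≤ c' := by
    have : 0 ≤ normSq r := by rw [hr2]; positivity
    rw [hc'] at this
    exact nonneg_of_mul_nonneg_right this ha'
  have hca : c' ≤ a := by
    have : (a : ℤ) * c' ≤ a * a := by rw [← hc', hr2]; nlinarith
    exact le_of_mul_le_mul_left this ha'
  lift c' to ℕ using hc0
  obtain ⟨d, e, hde, hd, -⟩ : ∃ d e : Quaternion ℤ, r = d * e ∧ normSq d = (a : ℤ) ∧
      normSq e = (c' : ℤ) := by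
    rcases lt_or_eq_of_le hca with hlt | heq
    -- Conjugation reverses products, so a left factor of norm `c'` of `star r` leaves a left factor
    -- of norm `a` of `r`.
    · obtain ⟨d, e, hde, hd, he⟩ := ih c' (by exact_mod_cast hlt) a (star r)
        (by rw [normSq_star, hc', mul_comm])
      exact ⟨star e, star d, by rw [← star_mul, ← hde, star_star],
        by rw [normSq_star, he], by rw [normSq_star, hd]⟩
    -- No descent here: every coordinate of `r` is `-a / 2`, so with `a = 2 n` one has `r = -n (1 +
    -- i + j + k) = n (1 + i) (-1 - j)`, and `n` splits as `p * star p`.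
    · rw [heq] at hc' ⊢
      have key : 4 * (r₁ ^ 2 + r₂ ^ 2 + r₃ ^ 2 + r₄ ^ 2) = 4 * (a * a : ℤ) := by
        rw [← hr2, hc']
      have hhalf : ∀ x : ℤ, -(a : ℤ) ≤ 2 * x → 2 * x < a → 4 * x ^ 2 = (a : ℤ) ^ 2 →
          2 * x = -a := by
        intro x h1 h2 h3
        have : (2 * x + a) * (2 * x - a) = 0 := by linear_combination h3
        rcases mul_eq_zero.1 this with h | h <;> omega
      have t₁ := hhalf r₁ l₁ u₁ (by linarith)
      have t₂ := hhalf r₂ l₂ u₂ (by linarith)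
      have t₃ := hhalf r₃ l₃ u₃ (by linarith)
      have t₄ := hhalf r₄ l₄ u₄ (by linarith)
      obtain ⟨n, hn⟩ : ∃ n : ℕ, a = 2 * n := ⟨a / 2, by omega⟩
      obtain ⟨p, hp⟩ := exists_normSq_eq_natCast n
      have hnr : (n : ℤ) = -r₁ := by omega
      refine ⟨ofCoords 1 1 0 0 * p, star p * ofCoords (-1) 0 (-1) 0, ?_, ?_, ?_⟩
      · rw [mul_assoc, ← mul_assoc p, self_mul_star, hp, hnr, hr,
          show r₂ = r₁ by omega, show r₃ = r₁ by omega, show r₄ = r₁ by omega]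
        ext <;> simp
      · rw [map_mul, hp, normSq_ofCoords, hn]
        push_cast
        ring
      · rw [map_mul, normSq_star, hp, normSq_ofCoords, hn]
        push_cast
        ring
  -- Since `a = d * star d`, a left factor `d` of the remainder `r` also divides `q = r + a k`.
  have hq' : q = d * (e + star d * k) := by
    rw [mul_add, ← mul_assoc, self_mul_star, hd, ← hde, hqr]
    congr 2
  refine ⟨d, _, hq', hd, ?_⟩
  rw [hq', map_mul, hd] at hq
  exact mul_left_cancel₀ ha'.ne' hq

/-- A positive semidefinite binary form whose determinant is a sum of three squares is a sum of
four squares of linear forms. -/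
theorem exists_normSq_eq_of_det_eq_sum_three_sq {A B C x y z : ℤ} (hA : 0 ≤ A) (hC : 0 ≤ C)
    (h : A * C - B ^ 2 = x ^ 2 + y ^ 2 + z ^ 2) :
    ∃ v w : Quaternion ℤ, normSq v = A ∧ (v * star w).re = B ∧ normSq w = C := by
  lift A to ℕ using hA
  lift C to ℕ using hC
  obtain ⟨d, e, hde, hd, he⟩ := exists_eq_mul_of_normSq_eq_mul A C (ofCoords B x y z)
    (by rw [normSq_ofCoords]; linear_combination -h)
  exact ⟨d, star e, hd, by rw [star_star, ← hde, re_ofCoords], by rw [normSq_star, he]⟩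

end Quaternion

/-! ### Reduction of ternary forms and the three squares theorem. -/

theorem Int.three_mul_sq_le_of_mul_eq_add_sq {a b d t : ℤ} (ha : 0 < a) (hab : a ≤ b)
    (h : a * b = d + t ^ 2) (hl : -a ≤ 2 * t) (hu : 2 * t < a) : 3 * a ^ 2 ≤ 4 * d := by
  have h₁ : 0 ≤ (2 * t + a) * (a - 2 * t) := mul_nonneg (by linarith) (by linarith)
  have h₂ := mul_le_mul_of_nonneg_left hab ha.le
  linarith

theorem Int.eq_one_of_three_mul_sq_le {a b : ℤ} (ha : 0 < a) (hb : 0 < b)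
    (hab : 3 * a ^ 2 ≤ 4 * b) (hba : 3 * b ^ 2 ≤ 4 * a) : a = 1 ∧ b = 1 := by
  have h₁ : a ≤ b ∨ b ≤ a := le_total a b
  have h₂ : a ≤ 1 := by rcases h₁ with h | h <;> nlinarith
  have h₃ : b ≤ 1 := by rcases h₁ with h | h <;> nlinarith
  omega

/-- Every positive definite integral ternary form of determinant one is a sum of three squares of
integral linear forms; this is stated for a single value of the form. -/
theorem exists_sum_three_sq_of_ternary_form (N M : ℕ) : ∀ a b c r s t x y z : ℤ,
    0 < a → a ≤ N → 0 < a * b - t ^ 2 → a * b - t ^ 2 ≤ M →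
    a * b * c + 2 * r * s * t - a * r ^ 2 - b * s ^ 2 - c * t ^ 2 = 1 →
    ∃ u v w : ℤ, a * x ^ 2 + b * y ^ 2 + c * z ^ 2 + 2 * r * y * z + 2 * s * x * z
      + 2 * t * x * y = u ^ 2 + v ^ 2 + w ^ 2 := by
  induction N generalizing M with
  | zero => intro a b c r s t x y z h1 h2; omega
  | succ N ihN =>
  induction M with
  | zero => intro a b c r s t x y z h1 h2 h3 h4; omega
  | succ M ihM =>
  intro a b c r s t x y z ha haN hG hGM hdet
  -- Up to sign, `g` is the off-diagonal entry of a binary block of the adjoint form with diagonal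
  -- `a b - t²`, `a c' - s'²` and determinant `a`. This block is reduced alternately with the block
  -- `a, t, b` of determinant `a b - t²`.
  obtain ⟨k, g, hk, hgl, hgu⟩ := Int.exists_mul_add_two_mul_le _ (a * r - s * t) hG
  set c' := c - 2 * k * r + k ^ 2 * b with hc'
  set r' := r - k * b with hr'
  set s' := s - k * t with hs'
  have hg : a * r' - s' * t = g := by rw [hr', hs']; linear_combination hk
  have hdet' : a * b * c' + 2 * r' * s' * t - a * r' ^ 2 - b * s' ^ 2 - c' * t ^ 2 = 1 := by
    rw [hr', hs', hc']; linear_combination hdet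
  have hform : a * x ^ 2 + b * y ^ 2 + c * z ^ 2 + 2 * r * y * z + 2 * s * x * z
      + 2 * t * x * y = a * x ^ 2 + b * (y + k * z) ^ 2 + c' * z ^ 2 + 2 * r' * (y + k * z) * z
      + 2 * s' * x * z + 2 * t * x * (y + k * z) := by
    rw [hr', hs', hc']; ring
  rw [hform]
  generalize y + k * z = y'
  clear_value c' r' s'
  have hprod : (a * b - t ^ 2) * (a * c' - s' ^ 2) = a + g ^ 2 := by
    rw [← hg]; linear_combination a * hdet'
  have hG' : 0 < a * c' - s' ^ 2 := by
    refine pos_of_mul_pos_right (a := a * b - t ^ 2) ?_ hG.le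
    rw [hprod]; positivity
  by_cases hlt : a * c' - s' ^ 2 < a * b - t ^ 2
  · obtain ⟨u, v, w, h⟩ := ihM a c' b r' t s' x z y' ha haN hG' (by push_cast at hGM; omega)
      (by linear_combination hdet')
    exact ⟨u, v, w, by rw [← h]; ring⟩
  obtain ⟨l, t', hl, htl, htu⟩ := Int.exists_mul_add_two_mul_le a t ha
  set b' := b - 2 * l * t + l ^ 2 * a with hb'
  set r'' := r' - l * s' with hr''
  have ht : t' = t - l * a := by rw [hl]; ring
  have hbt : a * b' - t' ^ 2 = a * b - t ^ 2 := by rw [hb', ht]; ring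
  have hgs : a * r'' - s' * t' = g := by rw [hr'', ht, ← hg]; ring
  have hdet'' : a * b' * c' + 2 * r'' * s' * t' - a * r'' ^ 2 - b' * s' ^ 2 - c' * t' ^ 2 = 1 := by
    rw [hr'', hb', ht]; linear_combination hdet'
  have hform' : a * x ^ 2 + b * y' ^ 2 + c' * z ^ 2 + 2 * r' * y' * z
      + 2 * s' * x * z + 2 * t * x * y' = a * (x + l * y') ^ 2 + b' * y' ^ 2 + c' * z ^ 2
      + 2 * r'' * y' * z + 2 * s' * (x + l * y') * z + 2 * t' * (x + l * y') * y' := by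
    rw [hr'', hb', ht]; ring
  rw [hform']
  generalize x + l * y' = x'
  clear_value b' r''
  rw [← hbt] at hprod hG hGM hgl hgu hlt
  have hb0 : 0 < b' := by
    refine pos_of_mul_pos_right (a := a) ?_ ha.le
    linarith [sq_nonneg t']
  by_cases hba : b' < a
  · obtain ⟨u, v, w, h⟩ := ihN (a * b' - t' ^ 2).toNat b' a c' s' r'' t' y' x' z hb0
      (by push_cast at haN; omega) (by linarith) (by rw [Int.toNat_of_nonneg hG.le]; linarith)
      (by linear_combination hdet'')
    exact ⟨u, v, w, by rw [← h]; ring⟩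
  push Not at hba hlt
  -- Both blocks are now reduced, so `3 a² ≤ 4 G` and `3 G² ≤ 4 a`, which leaves only `a = G = 1`.
  set G := a * b' - t' ^ 2 with hGdef
  obtain ⟨rfl, hG1⟩ := Int.eq_one_of_three_mul_sq_le ha hG
    (Int.three_mul_sq_le_of_mul_eq_add_sq ha hba (by rw [hGdef]; ring) htl htu)
    (Int.three_mul_sq_le_of_mul_eq_add_sq hG hlt hprod hgl hgu)
  rw [hG1] at hgl hgu hprod hGdef
  obtain rfl : g = 0 := by omega
  refine ⟨x' + t' * y' + s' * z, y', z, ?_⟩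
  linear_combination (-y' ^ 2) * hGdef + (z ^ 2) * hprod + 2 * y' * z * hgs

/-- With `h² + b = a (b n - 1)`, the symmetric matrix with rows `(a, h, 1)`, `(h, b n - 1, 0)`, `(1,
0, n)` has determinant one, and its form takes the value `n` at `(0, 0, 1)`. -/
theorem Int.exists_sum_three_sq_of_dvd {n b h : ℤ} (hb : 0 < b) (hn : 0 < b * n - 1)
    (hdvd : b * n - 1 ∣ h ^ 2 + b) : ∃ x y z : ℤ, n = x ^ 2 + y ^ 2 + z ^ 2 := by
  obtain ⟨a, ha⟩ := hdvd
  have ha0 : 0 < a := by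
    refine pos_of_mul_pos_right (a := b * n - 1) ?_ hn.le
    rw [← ha]; positivity
  obtain ⟨u, v, w, h⟩ := exists_sum_three_sq_of_ternary_form a.toNat b.toNat a (b * n - 1) n 0 1 h
    0 0 1 ha0 (by omega) (by nlinarith) (by rw [Int.toNat_of_nonneg hb.le]; nlinarith)
    (by linear_combination (-n) * ha)
  exact ⟨u, v, w, by rw [← h]; ring⟩

theorem Nat.exists_prime_eq_mul_add {n q : ℕ} (hn : 0 < n) (h : Nat.Coprime q (4 * n)) :
    ∃ p j : ℕ, p.Prime ∧ 0 < j ∧ p = 4 * n * j + q := by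
  have : NeZero (4 * n) := ⟨by omega⟩
  obtain ⟨p, hp, hpp, hpq⟩ := Nat.forall_exists_prime_gt_and_eq_mod
    ((ZMod.isUnit_iff_coprime q (4 * n)).2 h) (q + 4 * n)
  have hmod := (ZMod.natCast_eq_natCast_iff _ _ _).1 hpq
  obtain ⟨j, hj⟩ := (Nat.modEq_iff_dvd' (by omega)).1 hmod.symm
  refine ⟨p, j, hpp, ?_, by omega⟩
  rcases Nat.eq_zero_or_pos j with rfl | h
  · omega
  · exact h

theorem exists_dvd_sq_add_of_jacobiSym {p b : ℕ} (hp : p.Prime) (h : jacobiSym (-b) p = 1) :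
    ∃ x : ℤ, (p : ℤ) ∣ x ^ 2 + b := by
  have : Fact p.Prime := ⟨hp⟩
  obtain ⟨y, hy⟩ := ZMod.isSquare_of_jacobiSym_eq_one h
  obtain ⟨x, rfl⟩ := ZMod.intCast_surjective y
  refine ⟨x, (ZMod.intCast_zmod_eq_zero_iff_dvd _ p).1 ?_⟩
  push_cast at hy ⊢
  linear_combination -hy

open NumberTheorySymbols in
/-- **Legendre's three squares theorem**, for integers not divisible by four. -/
theorem Nat.exists_sum_three_sq {n : ℕ} (h : n % 4 = 2 ∨ n % 8 = 3 ∨ n % 4 = 1) :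
    ∃ x y z : ℤ, (n : ℤ) = x ^ 2 + y ^ 2 + z ^ 2 := by
  by_cases hn2 : n % 4 = 2
  -- Here `p = b n - 1` with `b = 4 j + 1`, so `p ≡ -1` modulo `b`, and reciprocity makes `-b` a
  -- square modulo `p`.
  · obtain ⟨p, j, hp, hj, hpj⟩ := Nat.exists_prime_eq_mul_add (n := n) (q := n - 1) (by omega) <| by
      apply Nat.Coprime.mul_right
      · exact Nat.Coprime.pow_right 2 (Nat.Coprime.symm (Nat.coprime_two_left.2
          (Nat.odd_iff.2 (by omega))))
      · exact (Nat.coprime_self_sub_left (by omega)).2 (by simp)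
    have hp4 : p % 4 = 1 := by rw [hpj, mul_assoc]; omega
    have hpb : (p : ℤ) = (4 * j + 1 : ℕ) * n - 1 := by
      rw [hpj]; push_cast [show 1 ≤ n by omega]; ring
    obtain ⟨x, hx⟩ := exists_dvd_sq_add_of_jacobiSym (b := 4 * j + 1) hp <| by
      rw [jacobiSym.neg _ (Nat.odd_iff.2 (by omega)), ZMod.χ₄_nat_one_mod_four hp4,
        jacobiSym.quadratic_reciprocity_one_mod_four (by omega) (Nat.odd_iff.2 (by omega)),
        jacobiSym.mod_left' (a₂ := -1), jacobiSym.at_neg_one (Nat.odd_iff.2 (by omega)),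
        ZMod.χ₄_nat_one_mod_four (by omega), one_mul]
      rw [hpb]
      exact Int.ModEq.symm ((Int.modEq_iff_dvd).2 ⟨n, by ring⟩)
    refine Int.exists_sum_three_sq_of_dvd (b := (4 * j + 1 : ℕ)) (h := x) (by positivity) ?_ ?_
    · rw [← hpb]; exact_mod_cast hp.pos
    · rwa [← hpb]
  -- For odd `n` the modulus is `2 p = b n - 1` with `b = 8 j + c`; `c` is chosen so that `q = (c n
  -- - 1) / 2` is odd and the symbol of `-b` modulo `p` is one.
  · obtain ⟨c, hc⟩ : ∃ c : ℕ, (c = 1 ∧ n % 8 = 3) ∨ (c = 3 ∧ n % 4 = 1) := by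
      rcases h with h | h | h
      · omega
      · exact ⟨1, by omega⟩
      · exact ⟨3, by omega⟩
    obtain ⟨q, hq⟩ : ∃ q, c * n = 2 * q + 1 := by
      rcases hc with ⟨rfl, h⟩ | ⟨rfl, h⟩
      · exact ⟨(n - 1) / 2, by omega⟩
      · exact ⟨(3 * n - 1) / 2, by omega⟩
    have hq2 : q % 2 = 1 := by rcases hc with ⟨rfl, h⟩ | ⟨rfl, h⟩ <;> omega
    have hq4 : c = 1 → q % 4 = 1 := by rcases hc with ⟨rfl, h⟩ | ⟨rfl, h⟩ <;> omega
    obtain ⟨p, j, hp, hj, hpj⟩ := Nat.exists_prime_eq_mul_add (n := n) (q := q) (by omega) <| by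
      apply Nat.Coprime.mul_right
      · exact Nat.Coprime.pow_right 2 (Nat.Coprime.symm (Nat.coprime_two_left.2
          (Nat.odd_iff.2 hq2)))
      · apply Nat.isCoprime_iff_coprime.1
        refine ⟨-2, c, ?_⟩
        have : (c * n : ℤ) = 2 * q + 1 := by exact_mod_cast hq
        linear_combination this
    set b := 8 * j + c with hb
    have hpb : (2 * p : ℤ) = b * n - 1 := by
      have : (c * n : ℤ) = 2 * q + 1 := by exact_mod_cast hq
      rw [hpj, hb]; push_cast; linear_combination -this
    have hpq4 : p % 4 = q % 4 := by rw [hpj, mul_assoc, Nat.mul_add_mod]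
    have hbodd : Odd b := Nat.odd_iff.2 (by omega)
    have hpodd : Odd p := Nat.odd_iff.2 (by omega)
    have h2p : J(2 | b) * J(p | b) = J(-1 | b) := by
      rw [← jacobiSym.mul_left, hpb]
      apply jacobiSym.mod_left'
      exact Int.ModEq.symm ((Int.modEq_iff_dvd).2 ⟨n, by ring⟩)
    rw [jacobiSym.at_two hbodd, jacobiSym.at_neg_one hbodd] at h2p
    obtain ⟨x, hx⟩ := exists_dvd_sq_add_of_jacobiSym (b := b) hp <| by
      rw [jacobiSym.neg _ hpodd]
      by_cases hb1 : c = 1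
      · rw [ZMod.χ₄_nat_one_mod_four (by omega), ZMod.χ₈_nat_eq_if_mod_eight,
          if_neg (by omega), if_pos (by omega)] at h2p
        rw [ZMod.χ₄_nat_one_mod_four (by omega),
          jacobiSym.quadratic_reciprocity_one_mod_four (by omega) hpodd]
        linarith
      · rw [ZMod.χ₄_nat_three_mod_four (by omega), ZMod.χ₈_nat_eq_if_mod_eight,
          if_neg (by omega), if_neg (by omega)] at h2p
        by_cases hp4 : p % 4 = 1
        · rw [ZMod.χ₄_nat_one_mod_four hp4,
            ← jacobiSym.quadratic_reciprocity_one_mod_four hp4 hbodd]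
          linarith
        · rw [ZMod.χ₄_nat_three_mod_four (by omega),
            jacobiSym.quadratic_reciprocity_three_mod_four (by omega) (by omega)]
          linarith
    -- As `b` is odd, an odd root makes `y² + b` divisible by `2` as well as by `p`.
    obtain ⟨y, hy, hyodd⟩ : ∃ y : ℤ, (p : ℤ) ∣ y ^ 2 + b ∧ y % 2 = 1 := by
      rcases Int.emod_two_eq_zero_or_one x with h0 | h1
      · refine ⟨x + p, ?_, by have := Nat.odd_iff.1 hpodd; omega⟩
        rw [show (x + p) ^ 2 + b = x ^ 2 + b + p * (2 * x + p) by ring]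
        exact dvd_add hx (dvd_mul_right _ _)
      · exact ⟨x, hx, h1⟩
    refine Int.exists_sum_three_sq_of_dvd (b := b) (h := y) (by omega) ?_ ?_
    · rw [← hpb]; have := hp.pos; omega
    · rw [← hpb]
      refine IsCoprime.mul_dvd ?_ ?_ hy
      · exact (Nat.isCoprime_iff_coprime (m := 2)).2 (Nat.coprime_two_left.2 hpodd)
      · have hb2 : (b : ℤ) % 2 = 1 := by have := Nat.odd_iff.1 hbodd; omega
        have : y ^ 2 % 2 = 1 := by rw [pow_two, Int.mul_emod, hyodd]; rfl
        omega

/-! ### Mordell's theorem on binary forms. -/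

/-- The binary form `A x² + 2 B x y + C y²` is a sum of five squares of integral linear forms. -/
def IsSumFiveSqLinearForms (A B C : ℤ) : Prop :=
  ∃ v w : Fin 5 → ℤ, ∑ i, v i ^ 2 = A ∧ ∑ i, v i * w i = B ∧ ∑ i, w i ^ 2 = C

namespace IsSumFiveSqLinearForms

variable {A B C : ℤ}

theorem symm (h : IsSumFiveSqLinearForms A B C) : IsSumFiveSqLinearForms C B A := by
  obtain ⟨v, w, hA, hB, hC⟩ := h
  exact ⟨w, v, hC, by simpa only [mul_comm] using hB, hA⟩

theorem neg (h : IsSumFiveSqLinearForms A B C) : IsSumFiveSqLinearForms A (-B) C := by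
  obtain ⟨v, w, hA, hB, hC⟩ := h
  exact ⟨v, -w, hA, by simp [← hB], by simp [← hC]⟩

theorem add_left (h : IsSumFiveSqLinearForms A B C) :
    IsSumFiveSqLinearForms A (B + A) (C + 2 * B + A) := by
  obtain ⟨v, w, rfl, rfl, rfl⟩ := h
  refine ⟨v, w + v, rfl, ?_, ?_⟩ <;> simp only [Fin.sum_univ_five, Pi.add_apply] <;> ring

theorem four_mul (h : IsSumFiveSqLinearForms A B C) :
    IsSumFiveSqLinearForms (4 * A) (2 * B) C := by
  obtain ⟨v, w, rfl, rfl, rfl⟩ := h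
  refine ⟨2 * v, w, ?_, ?_, rfl⟩ <;>
    simp only [Fin.sum_univ_five, Pi.mul_apply, Pi.ofNat_apply] <;> ring

/-- The left side of `h` is the determinant after subtracting the square of `p x + q y`; the
remainder is semidefinite and hence four squares. -/
theorem of_sum_three_sq {p q x y z : ℤ} (hA : 0 < A) (hC : 0 < C) (hd : 0 < A * C - B ^ 2)
    (h : A * C - B ^ 2 - (A * q ^ 2 - 2 * B * p * q + C * p ^ 2) = x ^ 2 + y ^ 2 + z ^ 2) :
    IsSumFiveSqLinearForms A B C := by
  have h0 : 0 ≤ A * C - B ^ 2 - (A * q ^ 2 - 2 * B * p * q + C * p ^ 2) := by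
    rw [h]; positivity
  have hp : 0 ≤ A - p ^ 2 := by
    refine nonneg_of_mul_nonneg_right (a := A * C - B ^ 2) ?_ hd
    linarith [mul_nonneg hA.le h0, sq_nonneg (A * q - B * p)]
  have hq : 0 ≤ C - q ^ 2 := by
    refine nonneg_of_mul_nonneg_right (a := A * C - B ^ 2) ?_ hd
    linarith [mul_nonneg hC.le h0, sq_nonneg (C * p - B * q)]
  obtain ⟨v, w, hv, hvw, hw⟩ := Quaternion.exists_normSq_eq_of_det_eq_sum_three_sq
    (B := B - p * q) (x := x) (y := y) (z := z) hp hq (by linear_combination h)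
  rw [Quaternion.normSq_def'] at hv hw
  refine ⟨![p, v.re, v.imI, v.imJ, v.imK], ![q, w.re, w.imI, w.imJ, w.imK], ?_, ?_, ?_⟩
  · simp [Fin.sum_univ_five]; linarith
  · simp at hvw
    simp [Fin.sum_univ_five]; linarith
  · simp [Fin.sum_univ_five]; linarith

end IsSumFiveSqLinearForms

theorem Int.exists_sum_three_sq {n : ℤ} (hn : 0 ≤ n) (h0 : (n : ZMod 8) ≠ 0)
    (h4 : (n : ZMod 8) ≠ 4) (h7 : (n : ZMod 8) ≠ 7) :
    ∃ x y z : ℤ, n = x ^ 2 + y ^ 2 + z ^ 2 := by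
  lift n to ℕ using hn
  apply Nat.exists_sum_three_sq
  have e0 := (ZMod.intCast_eq_intCast_iff' n 0 8).not.1 (by simpa using h0)
  have e4 := (ZMod.intCast_eq_intCast_iff' n 4 8).not.1 (by simpa using h4)
  have e7 := (ZMod.intCast_eq_intCast_iff' n 7 8).not.1 (by simpa using h7)
  push_cast at e0 e4 e7
  omega

/-- When the determinant is `7` modulo `8`, subtracting the square of `y`, `x` or `x + y` moves it
to a class covered by the three squares theorem. The condition `b ≠ 0` serves to keep the third
determinant nonnegative. -/
theorem ZMod.exists_sub_ne_of_mul_sub_sq_eq_seven : ∀ a b c : ZMod 8, a * c - b ^ 2 = 7 →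
    (7 - a ≠ 0 ∧ 7 - a ≠ 4 ∧ 7 - a ≠ 7) ∨ (7 - c ≠ 0 ∧ 7 - c ≠ 4 ∧ 7 - c ≠ 7) ∨
    (b ≠ 0 ∧ 7 - (a + c - 2 * b) ≠ 0 ∧ 7 - (a + c - 2 * b) ≠ 4 ∧
      7 - (a + c - 2 * b) ≠ 7) := by
  decide +kernel

open IsSumFiveSqLinearForms in
/-- **Mordell's theorem** for a reduced form which is not obtained from a smaller form. -/
theorem isSumFiveSqLinearForms_of_reduced {A B C : ℤ} (hA : 0 < A) (hAC : A ≤ C) (hB : 0 ≤ B)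
    (hBA : 2 * B ≤ A) (h : (A * C - B ^ 2) % 4 = 0 → A % 4 = 2) :
    IsSumFiveSqLinearForms A B C := by
  have hC : 0 < C := by omega
  have hBB : 4 * B ^ 2 ≤ A ^ 2 := by nlinarith
  have hAA : A ^ 2 ≤ A * C := by nlinarith
  have hd : 0 < A * C - B ^ 2 := by nlinarith
  have hA1 : A = 1 ∧ B = 0 ∨ 2 ≤ A := by omega
  have hdA : 0 ≤ A * C - B ^ 2 - A := by
    rcases hA1 with ⟨rfl, rfl⟩ | hA2 <;> nlinarith
  have hdC : 0 ≤ A * C - B ^ 2 - C := by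
    rcases hA1 with ⟨rfl, rfl⟩ | hA2
    · omega
    · nlinarith [mul_nonneg (sub_nonneg.2 hA2) (sub_nonneg.2 hAC)]
  by_cases h0 : (A * C - B ^ 2) % 4 = 0
  · have hA2 := h h0
    obtain ⟨x, y, z, hxyz⟩ : ∃ x y z : ℤ, A * C - B ^ 2 - A = x ^ 2 + y ^ 2 + z ^ 2 := by
      have := @Nat.exists_sum_three_sq (A * C - B ^ 2 - A).toNat (by omega)
      rwa [Int.toNat_of_nonneg hdA] at this
    exact of_sum_three_sq (p := 0) (q := 1) hA hC hd (by rw [← hxyz]; ring)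
  by_cases h7 : (A * C - B ^ 2) % 8 = 7
  · have h7' : ((A * C - B ^ 2 : ℤ) : ZMod 8) = 7 := by
      have := (ZMod.intCast_eq_intCast_iff' (A * C - B ^ 2) 7 8).2 (by push_cast; omega)
      simpa using this
    have hcast := h7'
    push_cast at hcast
    rcases ZMod.exists_sub_ne_of_mul_sub_sq_eq_seven A B C hcast with
      ⟨g0, g4, g7⟩ | ⟨g0, g4, g7⟩ | ⟨hB0, g0, g4, g7⟩
    · obtain ⟨x, y, z, hxyz⟩ := Int.exists_sum_three_sq hdA (by rwa [Int.cast_sub, h7'])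
        (by rwa [Int.cast_sub, h7']) (by rwa [Int.cast_sub, h7'])
      exact of_sum_three_sq (p := 0) (q := 1) hA hC hd (by rw [← hxyz]; ring)
    · obtain ⟨x, y, z, hxyz⟩ := Int.exists_sum_three_sq hdC (by rwa [Int.cast_sub, h7'])
        (by rwa [Int.cast_sub, h7']) (by rwa [Int.cast_sub, h7'])
      exact of_sum_three_sq (p := 1) (q := 0) hA hC hd (by rw [← hxyz]; ring)
    · have hB1 : 1 ≤ B := by
        rcases hB.eq_or_lt with rfl | h
        · simp at hB0
        · exact h
      -- The expression equals `(A - 1) (C - 1) - (B - 1)²`.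
      have hnn : 0 ≤ A * C - B ^ 2 - (A + C - 2 * B) := by
        nlinarith [mul_le_mul (show B - 1 ≤ A - 1 by omega) (show B - 1 ≤ C - 1 by omega)
          (by omega) (by omega)]
      have hc : ((A * C - B ^ 2 - (A + C - 2 * B) : ℤ) : ZMod 8) = 7 - (A + C - 2 * B) := by
        rw [Int.cast_sub, h7']; push_cast; rfl
      obtain ⟨x, y, z, hxyz⟩ := Int.exists_sum_three_sq hnn (by rwa [hc]) (by rwa [hc])
        (by rwa [hc])
      exact of_sum_three_sq (p := 1) (q := 1) hA hC hd (by rw [← hxyz]; ring)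
  · obtain ⟨x, y, z, hxyz⟩ : ∃ x y z : ℤ, A * C - B ^ 2 = x ^ 2 + y ^ 2 + z ^ 2 := by
      have := @Nat.exists_sum_three_sq (A * C - B ^ 2).toNat (by omega)
      rwa [Int.toNat_of_nonneg hd.le] at this
    exact of_sum_three_sq (p := 0) (q := 0) hA hC hd (by rw [← hxyz]; ring)

open IsSumFiveSqLinearForms in
theorem isSumFiveSqLinearForms_of_add_le (N : ℕ) : ∀ A B C : ℤ, 0 ≤ A → 0 ≤ C → B ^ 2 ≤ A * C →
    A + C ≤ N → IsSumFiveSqLinearForms A B C := by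
  induction N with
  | zero =>
    intro A B C hA hC hB hN
    obtain rfl : A = 0 := by push_cast at hN; omega
    obtain rfl : C = 0 := by push_cast at hN; omega
    obtain rfl : B = 0 := by nlinarith
    exact ⟨0, 0, by simp, by simp, by simp⟩
  | succ N ih =>
  suffices H : ∀ A B C : ℤ, 0 ≤ A → A ≤ C → 0 ≤ B → B ^ 2 ≤ A * C → A + C ≤ N + 1 →
      IsSumFiveSqLinearForms A B C by
    have H' : ∀ A B C : ℤ, 0 ≤ A → A ≤ C → B ^ 2 ≤ A * C → A + C ≤ N + 1 →
        IsSumFiveSqLinearForms A B C := by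
      intro A B C hA hAC hB hN
      rcases le_total 0 B with h | h
      · exact H A B C hA hAC h hB hN
      · simpa using (H A (-B) C hA hAC (by omega) (by simpa using hB) hN).neg
    intro A B C hA hC hB hN
    push_cast at hN
    rcases le_total A C with h | h
    · exact H' A B C hA h hB hN
    · exact (H' C B A hC h (by rwa [mul_comm]) (by omega)).symm
  intro A B C hA hAC hB0 hB hN
  rcases hA.eq_or_lt with rfl | hA0
  · obtain rfl : B = 0 := by nlinarith
    obtain ⟨a, b, c, d, h⟩ := Nat.sum_four_squares C.toNat
    refine ⟨0, ![0, a, b, c, d], by simp, by simp, ?_⟩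
    have h' : (a ^ 2 + b ^ 2 + c ^ 2 + d ^ 2 : ℤ) = C.toNat := by exact_mod_cast h
    rw [Int.toNat_of_nonneg hAC] at h'
    simp [Fin.sum_univ_five, h']
  by_cases hBA : A < 2 * B
  · have hC' : 0 ≤ C - 2 * B + A := by
      refine nonneg_of_mul_nonneg_right (a := A) ?_ hA0
      linarith [sq_nonneg (B - A)]
    have := (ih A (B - A) (C - 2 * B + A) hA hC' (by linarith) (by omega)).add_left
    convert this using 1 <;> ring
  push Not at hBA
  by_cases h : (A * C - B ^ 2) % 4 = 0 → A % 4 = 2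
  · exact isSumFiveSqLinearForms_of_reduced hA0 hAC hB0 hBA h
  push Not at h
  -- Here the form takes a value divisible by `4` at a basis vector or at the difference of the two,
  -- with even off-diagonal entry. It therefore arises from a smaller integral form by doubling one
  -- variable.
  obtain ⟨hd4, hA2⟩ := h
  have hd : (4 : ℤ) ∣ A * C - B ^ 2 := Int.dvd_of_emod_eq_zero hd4
  by_cases hA4 : A % 4 = 0
  · obtain ⟨a, rfl⟩ := Int.dvd_of_emod_eq_zero hA4
    have hBe : Even B := by
      have : Even (B ^ 2) := by
        obtain ⟨k, hk⟩ := hd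
        exact even_iff_two_dvd.2 ⟨2 * a * C - 2 * k, by linear_combination -hk⟩
      exact (Int.even_pow.1 this).1
    obtain ⟨b, rfl⟩ := even_iff_two_dvd.1 hBe
    exact (ih a b C (by omega) (by omega) (by linarith) (by omega)).four_mul
  · have hAodd : Odd A := Int.odd_iff.2 (by omega)
    have hcop : IsCoprime (4 : ℤ) A := by
      have : IsCoprime (2 : ℤ) A := by
        obtain ⟨k, rfl⟩ := hAodd
        exact ⟨-k, 1, by ring⟩
      simpa using this.pow_left (m := 2)
    rcases Int.even_or_odd' B with ⟨b, rfl | rfl⟩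
    · have hC4 : (4 : ℤ) ∣ C := hcop.dvd_of_dvd_mul_left <| by
        have : A * C = A * C - (2 * b) ^ 2 + 4 * b ^ 2 := by ring
        rw [this]
        exact dvd_add hd (dvd_mul_right _ _)
      obtain ⟨c, rfl⟩ := hC4
      exact (ih A b c hA (by omega) (by linarith) (by omega)).symm.four_mul.symm
    · obtain ⟨a, rfl⟩ := hAodd
      set C' := C - 2 * (2 * b + 1) + (2 * a + 1) with hC'
      have hC4 : (4 : ℤ) ∣ C' := hcop.dvd_of_dvd_mul_left <| by
        have : (2 * a + 1) * C' = (2 * a + 1) * C - (2 * b + 1) ^ 2 + 4 * (b - a) ^ 2 := by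
          rw [hC']; ring
        rw [this]
        exact dvd_add hd (dvd_mul_right _ _)
      obtain ⟨c, hc⟩ := hC4
      have hdet : (2 * a + 1) * (4 * c) - (2 * (b - a)) ^ 2
          = (2 * a + 1) * C - (2 * b + 1) ^ 2 := by rw [← hc, hC']; ring
      have hc0 : 0 ≤ c := by
        refine nonneg_of_mul_nonneg_right (a := 2 * a + 1) ?_ hA0
        linarith [sq_nonneg (b - a)]
      have := (ih (2 * a + 1) (b - a) c hA hc0 (by linarith) (by omega)).symm.four_mul.symm.add_left
      convert this using 1
      · ring
      · rw [← hc, hC']; ring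

/-- **Mordell's theorem**: a positive semidefinite binary form with integral matrix is a sum of
five squares of integral linear forms. -/
theorem isSumFiveSqLinearForms_of_nonneg {A B C : ℤ} (hA : 0 ≤ A) (hC : 0 ≤ C)
    (hB : B ^ 2 ≤ A * C) : IsSumFiveSqLinearForms A B C :=
  isSumFiveSqLinearForms_of_add_le (A + C).toNat A B C hA hC hB (by omega)

/-! ### Integers of the real quadratic field and total positivity. -/

namespace QSqrt

variable {D : ℕ}

theorem sqrt_mem (D : ℕ) : Real.sqrt (D : ℝ) ∈ QSqrt D :=
  IntermediateField.mem_adjoin_simple_self ℚ _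

/-- `√D` as an element of the ring of integers of `ℚ(√D)`. -/
noncomputable def sqrtInt (D : ℕ) : 𝓞 (QSqrt D) :=
  ⟨⟨Real.sqrt D, sqrt_mem D⟩, by
    refine ⟨Polynomial.X ^ 2 - Polynomial.C (D : ℤ), Polynomial.monic_X_pow_sub_C _ two_ne_zero, ?_⟩
    apply Subtype.ext
    simp⟩

theorem coe_sqrtInt (D : ℕ) : (((sqrtInt D : 𝓞 (QSqrt D)) : QSqrt D) : ℝ) = Real.sqrt D := rfl

theorem sqrtInt_sq (D : ℕ) : sqrtInt D ^ 2 = (D : 𝓞 (QSqrt D)) := by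
  apply RingOfIntegers.ext
  apply Subtype.ext
  simp [coe_sqrtInt]

/-- The inclusion of the ring of integers of `ℚ(√D)` into `ℝ`. -/
noncomputable def toReal (D : ℕ) : 𝓞 (QSqrt D) →+* ℝ :=
  (algebraMap (QSqrt D) ℝ).comp (algebraMap (𝓞 (QSqrt D)) (QSqrt D))

theorem toReal_apply (x : 𝓞 (QSqrt D)) : toReal D x = ((x : QSqrt D) : ℝ) := rfl

@[simp] theorem toReal_sqrtInt (D : ℕ) : toReal D (sqrtInt D) = Real.sqrt D := rfl

theorem toReal_injective (D : ℕ) : Function.Injective (toReal D) :=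
  fun _ _ h ↦ RingOfIntegers.ext (Subtype.ext h)

theorem irrational_sqrt (hD : 2 ≤ D) (hsq : Squarefree D) : Irrational (Real.sqrt (D : ℝ)) := by
  rw [irrational_sqrt_natCast_iff]
  rintro ⟨r, hr⟩
  have : r = 1 := Nat.isUnit_iff.1 (hsq r ⟨1, by rw [hr, mul_one]⟩)
  subst this
  omega

theorem exists_conj (hD : 2 ≤ D) (hsq : Squarefree D) :
    ∃ τ : QSqrt D →+* ℝ, τ (sqrtInt D : QSqrt D) = -Real.sqrt D := by
  have hint : IsIntegral ℚ (Real.sqrt (D : ℝ)) :=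
    ⟨Polynomial.X ^ 2 - Polynomial.C (D : ℚ), Polynomial.monic_X_pow_sub_C _ two_ne_zero, by simp⟩
  have hirr : Irreducible (Polynomial.X ^ 2 - Polynomial.C (D : ℚ)) := by
    apply X_pow_sub_C_irreducible_of_prime Nat.prime_two
    intro b hb
    apply irrational_sqrt hD hsq
    refine ⟨|b|, ?_⟩
    rw [Rat.cast_abs, ← Real.sqrt_sq_eq_abs]
    congr 1
    exact_mod_cast hb
  have hmin : minpoly ℚ (Real.sqrt (D : ℝ)) = Polynomial.X ^ 2 - Polynomial.C (D : ℚ) :=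
    (minpoly.eq_of_irreducible_of_monic hirr (by simp)
      (Polynomial.monic_X_pow_sub_C _ two_ne_zero)).symm
  have hroot : -Real.sqrt (D : ℝ) ∈ (minpoly ℚ (Real.sqrt (D : ℝ))).aroots ℝ := by
    rw [Polynomial.mem_aroots, hmin]
    exact ⟨hirr.ne_zero, by simp⟩
  exact ⟨((IntermediateField.algHomAdjoinIntegralEquiv ℚ hint).symm ⟨_, hroot⟩ : _ →ₐ[ℚ] ℝ),
    IntermediateField.algHomAdjoinIntegralEquiv_symm_apply_gen ℚ hint ⟨_, hroot⟩⟩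

theorem exists_rat_coords (D : ℕ) (x : QSqrt D) :
    ∃ r q : ℚ, x = (r : QSqrt D) + (q : QSqrt D) * (sqrtInt D : QSqrt D) := by
  have hint : IsIntegral ℚ (Real.sqrt (D : ℝ)) :=
    ⟨Polynomial.X ^ 2 - Polynomial.C (D : ℚ), Polynomial.monic_X_pow_sub_C _ two_ne_zero, by simp⟩
  obtain ⟨x, hx⟩ := x
  suffices H : ∃ r q : ℚ, x = r + q * Real.sqrt D by
    obtain ⟨r, q, rfl⟩ := H
    refine ⟨r, q, ?_⟩
    apply Subtype.ext
    simp [coe_sqrtInt]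
  rw [← IntermediateField.mem_toSubalgebra,
    IntermediateField.adjoin_simple_toSubalgebra_of_isAlgebraic hint.isAlgebraic] at hx
  induction hx using Algebra.adjoin_induction with
  | mem x hx => exact ⟨0, 1, by simpa using hx⟩
  | algebraMap r => exact ⟨r, 0, by simp⟩
  | add x y _ _ hx hy =>
    obtain ⟨a, b, rfl⟩ := hx
    obtain ⟨c, d, rfl⟩ := hy
    exact ⟨a + c, b + d, by push_cast; ring⟩
  | mul x y _ _ hx hy =>
    obtain ⟨a, b, rfl⟩ := hx
    obtain ⟨c, d, rfl⟩ := hy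
    refine ⟨a * c + b * d * D, a * d + b * c, ?_⟩
    have := Real.sq_sqrt (Nat.cast_nonneg (α := ℝ) D)
    push_cast
    linear_combination (b * d : ℝ) * this

theorem exists_int_of_isIntegral {r : ℚ} {x : ℝ} (hx : IsIntegral ℤ x) (h : x = r) :
    ∃ n : ℤ, r = n := by
  subst h
  have : IsIntegral ℤ r :=
    (isIntegral_algebraMap_iff (algebraMap ℚ ℝ).injective).1 hx
  obtain ⟨n, hn⟩ := IsIntegrallyClosed.isIntegral_iff.1 this
  exact ⟨n, by simpa using hn.symm⟩

/-- The number `w = q D` is integral because its square is, and `D ∣ w²` gives `D ∣ w` for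
squarefree `D`. -/
theorem exists_int_of_sq_mul_eq (hsq : Squarefree D) {q : ℚ} {n : ℤ} (h : q ^ 2 * D = n) :
    ∃ v : ℤ, q = v := by
  have hD0 : (D : ℚ) ≠ 0 := by exact_mod_cast hsq.ne_zero
  obtain ⟨w, hw⟩ : ∃ w : ℤ, w = q * D := by
    have : IsIntegral ℤ (q * D) := by
      refine IsIntegral.of_pow two_pos ?_
      rw [show (q * D) ^ 2 = ((n * D : ℤ) : ℚ) by push_cast; rw [← h]; ring]
      exact isIntegral_algebraMap (R := ℤ) (A := ℚ) (x := n * D)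
    obtain ⟨w, hw⟩ := IsIntegrallyClosed.isIntegral_iff.1 this
    exact ⟨w, by simpa using hw⟩
  have hdvd : (D : ℤ) ∣ w ^ 2 := by
    refine ⟨n, ?_⟩
    have : (w : ℚ) ^ 2 = D * n := by rw [hw, ← h]; ring
    exact_mod_cast this
  have hsqZ : Squarefree (D : ℤ) := Int.squarefree_natCast.2 hsq
  obtain ⟨v, rfl⟩ := (hsqZ.dvd_pow_iff_dvd two_ne_zero).1 hdvd
  refine ⟨v, ?_⟩
  push_cast at hw
  exact mul_right_cancel₀ hD0 (by rw [← hw, mul_comm])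

/-- Trace and norm are integers: the trace is `u`, and four times the norm is `u² - D v²`. -/
theorem exists_half_int_coords (hD : 2 ≤ D) (hsq : Squarefree D) (x : 𝓞 (QSqrt D)) :
    ∃ u v : ℤ, 2 * x = u + v * sqrtInt D ∧ 4 ∣ u ^ 2 - D * v ^ 2 := by
  obtain ⟨τ, hτ⟩ := exists_conj hD hsq
  obtain ⟨r, q, hx⟩ := exists_rat_coords D x
  have hs := Real.sq_sqrt (Nat.cast_nonneg (α := ℝ) D)
  have h₁ : ((x : QSqrt D) : ℝ) = r + q * Real.sqrt D := by rw [hx]; simp [coe_sqrtInt]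
  have h₂ : τ x = r - q * Real.sqrt D := by rw [hx]; simp [hτ]; ring
  have i₁ : IsIntegral ℤ ((x : QSqrt D) : ℝ) :=
    map_isIntegral_int (QSqrt D).val x.isIntegral_coe
  have i₂ : IsIntegral ℤ (τ x) := map_isIntegral_int τ x.isIntegral_coe
  obtain ⟨u, hu⟩ := exists_int_of_isIntegral (r := 2 * r) (i₁.add i₂)
    (by rw [h₁, h₂]; push_cast; ring)
  obtain ⟨n, hn⟩ := exists_int_of_isIntegral (r := r ^ 2 - q ^ 2 * D) (i₁.mul i₂)
    (by rw [h₁, h₂]; push_cast; linear_combination (-(q : ℝ) ^ 2) * hs)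
  have hq : (2 * q) ^ 2 * D = ((u ^ 2 - 4 * n : ℤ) : ℚ) := by
    push_cast
    rw [← hu, ← hn]; ring
  obtain ⟨v, hv⟩ := exists_int_of_sq_mul_eq hsq hq
  refine ⟨u, v, ?_, n, ?_⟩
  · apply toReal_injective
    have hu' : (2 * r : ℝ) = u := by exact_mod_cast hu
    have hv' : (2 * q : ℝ) = v := by exact_mod_cast hv
    simp only [map_mul, map_add, map_ofNat, map_intCast, toReal_sqrtInt]
    rw [toReal_apply, h₁, ← hu', ← hv']
    ring
  · rw [hv] at hq
    have : v ^ 2 * (D : ℤ) = u ^ 2 - 4 * n := by exact_mod_cast hq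
    linear_combination -this

theorem mod_four_ne_zero (hsq : Squarefree D) : D % 4 ≠ 0 := by
  intro h
  obtain ⟨k, rfl⟩ := Nat.dvd_of_mod_eq_zero h
  have := Nat.isUnit_iff.1 (hsq 2 ⟨k, by ring⟩)
  omega

theorem kappa_cases (D : ℕ) : (D % 4 = 1 ∧ kappa D = 1) ∨ (D % 4 ≠ 1 ∧ kappa D = 2) := by
  unfold kappa
  split_ifs with h <;> simp [h]

/-- The factor `kappa D` treats both integral bases uniformly; parity constrains the coordinates
only if it is one. -/
theorem exists_coords (hD : 2 ≤ D) (hsq : Squarefree D) (x : 𝓞 (QSqrt D)) :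
    ∃ u v : ℤ, 2 * x = kappa D * (u + v * sqrtInt D) ∧ (kappa D = 1 → Even (u - v)) := by
  obtain ⟨u, v, h, k, hk⟩ := exists_half_int_coords hD hsq x
  have hD4 := mod_four_ne_zero hsq
  rcases kappa_cases D with ⟨h1, hκ⟩ | ⟨h1, hκ⟩
  · refine ⟨u, v, by simpa [hκ] using h, fun _ ↦ ?_⟩
    obtain ⟨m, hm⟩ : ∃ m : ℤ, (D : ℤ) = 4 * m + 1 := ⟨D / 4, by omega⟩
    rw [hm] at hk
    have : Even (u ^ 2 - v ^ 2) := even_iff_two_dvd.2 ⟨2 * k + 2 * m * v ^ 2, by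
      linear_combination hk⟩
    simpa [parity_simps] using this
  · rcases Int.even_or_odd' v with ⟨b, rfl | rfl⟩
    · have hu : Even u := by
        have : Even (u ^ 2) := even_iff_two_dvd.2 ⟨2 * k + 2 * D * b ^ 2, by linear_combination hk⟩
        exact (Int.even_pow.1 this).1
      obtain ⟨a, rfl⟩ := even_iff_two_dvd.1 hu
      refine ⟨a, b, ?_, by omega⟩
      rw [h, hκ]
      push_cast
      ring
    · exfalso
      have hk' : u ^ 2 - D = 4 * (k + D * b * (b + 1)) := by linear_combination hk
      rcases Int.even_or_odd' u with ⟨a, rfl | rfl⟩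
      · have : (D : ℤ) = 4 * (a ^ 2 - (k + D * b * (b + 1))) := by linear_combination -hk'
        omega
      · have : (D : ℤ) = 4 * (a ^ 2 + a - (k + D * b * (b + 1))) + 1 := by linear_combination -hk'
        omega

theorem exists_of_coords {u v : ℤ} (h : kappa D = 1 → Even (u - v)) :
    ∃ x : 𝓞 (QSqrt D), 2 * x = kappa D * (u + v * sqrtInt D) := by
  rcases kappa_cases D with ⟨h1, hκ⟩ | ⟨h1, hκ⟩
  · obtain ⟨m, hm⟩ : ∃ m : ℤ, (D : ℤ) = 4 * m + 1 := ⟨D / 4, by omega⟩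
    obtain ⟨k, hk⟩ := even_iff_two_dvd.1 (h hκ)
    have hs : (sqrtInt D : QSqrt D) ^ 2 = 4 * m + 1 := by
      have := congrArg (algebraMap (𝓞 (QSqrt D)) (QSqrt D)) (sqrtInt_sq D)
      rw [map_pow, map_natCast] at this
      rw [this]
      exact_mod_cast congrArg (Int.cast : ℤ → QSqrt D) hm
    obtain ⟨y, hy⟩ : ∃ y : QSqrt D, 2 * y = 1 + (sqrtInt D : QSqrt D) :=
      ⟨(1 + (sqrtInt D : QSqrt D)) / 2, mul_div_cancel₀ _ two_ne_zero⟩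
    have hint : IsIntegral ℤ y := by
      refine ⟨Polynomial.X ^ 2 - Polynomial.X - Polynomial.C m, ?_, ?_⟩
      · monicity!
      · rw [Polynomial.eval₂_sub, Polynomial.eval₂_sub, Polynomial.eval₂_pow, Polynomial.eval₂_X,
          Polynomial.eval₂_C, eq_intCast]
        linear_combination hs / 4 + (2 * y + (sqrtInt D : QSqrt D) - 1) / 4 * hy
    obtain ⟨w, rfl⟩ : ∃ w : 𝓞 (QSqrt D), (w : QSqrt D) = y := ⟨⟨y, hint⟩, rfl⟩
    have hw : 2 * w = 1 + sqrtInt D := FaithfulSMul.algebraMap_injective (𝓞 (QSqrt D)) (QSqrt D) (by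
      rw [map_mul, map_add, map_ofNat, map_one]
      exact hy)
    have hk' : (u - v : 𝓞 (QSqrt D)) = 2 * k := by exact_mod_cast congrArg Int.cast hk
    refine ⟨k + v * w, ?_⟩
    rw [hκ]
    push_cast
    linear_combination v * hw - hk'
  · refine ⟨u + v * sqrtInt D, by rw [hκ]; push_cast; ring⟩

theorem coords_unique (hD : 2 ≤ D) (hsq : Squarefree D) {a b c d : ℤ}
    (h : (a + b * sqrtInt D : 𝓞 (QSqrt D)) = c + d * sqrtInt D) : a = c ∧ b = d := by
  have h' : (a + b * Real.sqrt D : ℝ) = c + d * Real.sqrt D := by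
    simpa using congrArg (toReal D) h
  have hbd : b = d := by
    by_contra hne
    have hne' : ((b - d : ℤ) : ℝ) ≠ 0 := by exact_mod_cast sub_ne_zero.2 hne
    apply irrational_sqrt hD hsq
    refine ⟨((c - a : ℤ) : ℚ) / ((b - d : ℤ) : ℚ), ?_⟩
    push_cast at hne' ⊢
    rw [div_eq_iff hne']
    linear_combination -h'
  subst hbd
  exact ⟨by exact_mod_cast add_right_cancel h', rfl⟩

theorem kappa_pos (D : ℕ) : 0 < kappa D := by
  rcases kappa_cases D with ⟨-, h⟩ | ⟨-, h⟩ <;> omega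

theorem map_coords {x : 𝓞 (QSqrt D)} {u v : ℤ} (h : 2 * x = kappa D * (u + v * sqrtInt D))
    (σ : QSqrt D →+* ℝ) : 2 * σ x = kappa D * (u + v * σ (sqrtInt D : QSqrt D)) := by
  have := congrArg (σ.comp (algebraMap (𝓞 (QSqrt D)) (QSqrt D))) h
  rw [map_mul, map_mul, map_add, map_mul, map_ofNat, map_natCast, map_intCast, map_intCast] at this
  exact this

theorem mem_totallyPositive_of_coords {x : 𝓞 (QSqrt D)} {u v : ℤ}
    (h : 2 * x = kappa D * (u + v * sqrtInt D)) (hu : 0 < u) (huv : D * v ^ 2 < u ^ 2) :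
    x ∈ totallyPositiveIntegers (QSqrt D) := by
  intro σ
  have hs : σ (sqrtInt D : QSqrt D) ^ 2 = D := by
    rw [← map_pow, ← map_pow, sqrtInt_sq]; simp
  have hσ := map_coords h σ
  have hκ : (0 : ℝ) < kappa D := by exact_mod_cast kappa_pos D
  have hu' : (0 : ℝ) < u := by exact_mod_cast hu
  have huv' : (v * σ (sqrtInt D : QSqrt D)) ^ 2 < (u : ℝ) ^ 2 := by
    rw [mul_pow, hs, mul_comm]; exact_mod_cast huv
  have := mul_pos hκ (show (0 : ℝ) < u + v * σ (sqrtInt D : QSqrt D) by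
    linarith [(abs_lt_of_sq_lt_sq' huv' hu'.le).1])
  linarith

theorem coords_of_mem_totallyPositive (hD : 2 ≤ D) (hsq : Squarefree D) {x : 𝓞 (QSqrt D)} {u v : ℤ}
    (h : 2 * x = kappa D * (u + v * sqrtInt D)) (hx : x ∈ totallyPositiveIntegers (QSqrt D)) :
    0 < u ∧ D * v ^ 2 < u ^ 2 := by
  obtain ⟨τ, hτ⟩ := exists_conj hD hsq
  have hs := Real.sq_sqrt (Nat.cast_nonneg (α := ℝ) D)
  have hκ : (0 : ℝ) < kappa D := by exact_mod_cast kappa_pos D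
  have key : ∀ σ : QSqrt D →+* ℝ, 0 < u + v * σ (sqrtInt D : QSqrt D) := by
    intro σ
    have hσ := map_coords h σ
    refine pos_of_mul_pos_right (a := (kappa D : ℝ)) ?_ hκ.le
    rw [← hσ]
    linarith [hx σ]
  have k₁ : 0 < u + v * Real.sqrt D := key ((QSqrt D).val : QSqrt D →+* ℝ)
  have k₂ := key τ
  rw [hτ] at k₂
  have hu : (0 : ℝ) < u := by linarith
  have huv : (D * v ^ 2 : ℝ) < u ^ 2 := by nlinarith [mul_pos k₁ k₂]
  exact ⟨by exact_mod_cast hu, by exact_mod_cast huv⟩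

end QSqrt

/-! ### Obstructions to being a sum of squares: (a) and (c). -/

namespace QSqrt

variable {D : ℕ}

/-- Four times a sum of squares in the ring of integers of `ℚ(√D)` has coordinates
`κ² (A + D C + 2 B √D)`, where `A`, `B`, `C` is the Gram matrix of a pair of integral vectors. -/
theorem exists_gram_of_isSumSq (hD : 2 ≤ D) (hsq : Squarefree D) {x : 𝓞 (QSqrt D)}
    (hx : IsSumSq x) : ∃ A B C : ℤ, 0 ≤ A ∧ 0 ≤ C ∧ (C = 0 → B = 0) ∧
      4 * x = kappa D ^ 2 * (A + D * C + 2 * B * sqrtInt D) := by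
  induction hx with
  | zero => exact ⟨0, 0, 0, le_rfl, le_rfl, fun _ ↦ rfl, by simp⟩
  | sq_add a hx ih =>
    obtain ⟨A, B, C, hA, hC, hCB, h⟩ := ih
    obtain ⟨u, v, ha, -⟩ := exists_coords hD hsq a
    refine ⟨A + u ^ 2, B + u * v, C + v ^ 2, by positivity, by positivity, ?_, ?_⟩
    · intro h0
      have h1 : v ^ 2 = 0 := by nlinarith [sq_nonneg v]
      rw [hCB (by omega), pow_eq_zero_iff two_ne_zero |>.1 h1]
      simp
    · push_cast
      linear_combination h + (2 * a + kappa D * (u + v * sqrtInt D)) * ha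
        + (kappa D * v : 𝓞 (QSqrt D)) ^ 2 * sqrtInt_sq D

/-- If a multiple `m α` with `2 α = κ (w + √D)` is a sum of squares, then `2 m` is a multiple of
`2 κ` and `κ D ≤ 2 m w`. -/
theorem le_and_dvd_of_isSumSq (hD : 2 ≤ D) (hsq : Squarefree D) {m : ℕ} (hm : 0 < m) {w : ℤ}
    {x : 𝓞 (QSqrt D)} (hx : 2 * x = kappa D * (w + sqrtInt D)) (h : IsSumSq (m * x)) :
    (kappa D : ℤ) * D ≤ 2 * m * w ∧ kappa D ∣ m := by
  obtain ⟨A, B, C, hA, hC, hCB, hABC⟩ := exists_gram_of_isSumSq hD hsq h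
  have hκ := kappa_pos D
  have key : ((kappa D * (2 * m * w) : ℤ) + (kappa D * (2 * m) : ℤ) * sqrtInt D : 𝓞 (QSqrt D))
      = (kappa D * (kappa D * (A + D * C)) : ℤ) + (kappa D * (kappa D * (2 * B)) : ℤ) * sqrtInt D := by
    push_cast
    linear_combination hABC - 2 * m * hx
  obtain ⟨h₁, h₂⟩ := coords_unique hD hsq key
  have hκ' : (kappa D : ℤ) ≠ 0 := by exact_mod_cast hκ.ne'
  have e₁ := mul_left_cancel₀ hκ' h₁
  have e₂ := mul_left_cancel₀ hκ' h₂
  have hmB : (m : ℤ) = kappa D * B := by linarith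
  have hC1 : 1 ≤ C := by
    by_contra! hlt
    rw [hCB (by omega)] at hmB
    omega
  refine ⟨?_, by exact_mod_cast Dvd.intro B hmB.symm⟩
  rw [e₁]
  have : (D : ℤ) ≤ A + D * C := by nlinarith
  exact mul_le_mul_of_nonneg_left this (by positivity)

theorem exists_not_isSumSq_of_lt (hD : 2 ≤ D) (hsq : Squarefree D) {m : ℕ} (hm : 0 < m)
    (h : (m : ℝ) < kappa D * Real.sqrt D / 4) :
    ∃ x ∈ totallyPositiveIntegers (QSqrt D), ¬ IsSumSq (m * x) := by
  have hs := Real.sq_sqrt (Nat.cast_nonneg (α := ℝ) D)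
  have hs0 := Real.sqrt_nonneg (D : ℝ)
  have hκ : (0 : ℝ) < kappa D := by exact_mod_cast kappa_pos D
  -- Take the least integer above `√D`, or the least odd one if `κ = 1`; hence `w ≤ √D + 2 / κ`.
  obtain ⟨w, hw, hws, hwκ⟩ : ∃ w : ℕ, D < w ^ 2 ∧ kappa D * (w : ℝ) ≤ kappa D * Real.sqrt D + 2 ∧
      (kappa D = 1 → Even ((w : ℤ) - 1)) := by
    have hl : D < (Nat.sqrt D + 1) ^ 2 := Nat.lt_succ_sqrt' D
    have hr : (Nat.sqrt D : ℝ) ≤ Real.sqrt D := Real.nat_sqrt_le_real_sqrt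
    rcases kappa_cases D with ⟨-, hκ⟩ | ⟨-, hκ⟩
    · rcases Nat.even_or_odd (Nat.sqrt D) with he | ho
      · exact ⟨Nat.sqrt D + 1, hl, by rw [hκ]; push_cast; linarith, fun _ ↦ by
          push_cast; simpa using he⟩
      · refine ⟨Nat.sqrt D + 2, hl.trans (by gcongr; omega), by rw [hκ]; push_cast; linarith,
          fun _ ↦ ?_⟩
        obtain ⟨k, hk⟩ := ho
        exact ⟨k + 1, by rw [hk]; push_cast; ring⟩
    · exact ⟨Nat.sqrt D + 1, hl, by rw [hκ]; push_cast; linarith, by omega⟩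
  obtain ⟨x, hx⟩ := exists_of_coords (D := D) (u := w) (v := 1) hwκ
  have hw' : (D : ℤ) < (w : ℤ) ^ 2 := by exact_mod_cast hw
  refine ⟨x, mem_totallyPositive_of_coords hx ?_ (by simpa using hw'), fun hsum ↦ ?_⟩
  · have : w ≠ 0 := by rintro rfl; simp at hw
    omega
  have hle := (le_and_dvd_of_isSumSq hD hsq hm (w := w) (by rw [hx, Int.cast_one, one_mul]) hsum).1
  have hle' : (kappa D : ℝ) * D ≤ 2 * m * w := by exact_mod_cast hle
  have hm' : (0 : ℝ) < m := by exact_mod_cast hm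
  have hw0 : (0 : ℝ) < w := by
    have : w ≠ 0 := by rintro rfl; simp at hw
    positivity
  have h1 : 2 * m * (w : ℝ) < kappa D * Real.sqrt D / 2 * w := by nlinarith
  have h2 : kappa D * Real.sqrt D / 2 * w ≤ Real.sqrt D / 2 * (kappa D * Real.sqrt D + 2) := by
    nlinarith
  -- Together, `κ D ≤ 2 m w < κ D / 2 + √D ≤ κ D`, a contradiction.
  have h3 : Real.sqrt D ≤ kappa D * D / 2 := by
    rcases kappa_cases D with ⟨h1, hκ⟩ | ⟨-, hκ⟩
    · rw [hκ]
      have : (2 : ℝ) ≤ Real.sqrt D := Real.le_sqrt_of_sq_le (by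
        have : 4 ≤ D := by omega
        have : (4 : ℝ) ≤ D := by exact_mod_cast this
        linarith)
      push_cast
      nlinarith
    · rw [hκ]
      have : (1 : ℝ) ≤ Real.sqrt D := Real.le_sqrt_of_sq_le (by
        have : (2 : ℝ) ≤ D := by exact_mod_cast hD
        linarith)
      push_cast
      nlinarith
  nlinarith

theorem exists_not_isSumSq_of_odd (hD : 2 ≤ D) (hsq : Squarefree D) {m : ℕ} (hm : Odd m)
    (h : D % 4 = 2 ∨ D % 4 = 3) :
    ∃ x ∈ totallyPositiveIntegers (QSqrt D), ¬ IsSumSq (m * x) := by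
  have hκ : kappa D = 2 := by
    rcases kappa_cases D with ⟨h', hκ⟩ | ⟨-, hκ⟩ <;> omega
  obtain ⟨x, hx⟩ := exists_of_coords (D := D) (u := D) (v := 1) (fun h ↦ by omega)
  refine ⟨x, mem_totallyPositive_of_coords hx (by positivity) ?_, fun hsum ↦ ?_⟩
  · have : (2 : ℤ) ≤ D := by exact_mod_cast hD
    nlinarith
  have := (le_and_dvd_of_isSumSq hD hsq hm.pos (w := D) (by rw [hx, Int.cast_one, one_mul]) hsum).2
  rw [hκ] at this
  exact (Nat.not_even_iff_odd.2 hm) (even_iff_two_dvd.2 this)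

/-! ### Representation by five squares: (b). -/

theorem exists_abs_sub_mul_le {d r n : ℤ} (hd : 0 < d) (hr : d ≤ 2 * r) :
    ∃ c : ℤ, -r ≤ d * c - n ∧ d * c - n ≤ r := by
  obtain ⟨k, s, h, hl, hu⟩ := Int.exists_mul_add_two_mul_le d n hd
  exact ⟨k, by omega, by omega⟩

/-- The Gram matrix entries `A = n - d C`, `B`, `C` form a positive semidefinite matrix, if `d C` is
close to `n / 2`. -/
theorem isSumFiveSqLinearForms_of_dist_le {d n r B C : ℤ} (hd : 0 < d) (hn : 0 < n)
    (hl : -r ≤ 2 * (d * C) - n) (hu : 2 * (d * C) - n ≤ r)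
    (hr : r ^ 2 ≤ n ^ 2 - 4 * d * B ^ 2) : IsSumFiveSqLinearForms (n - d * C) B C := by
  have h₁ : (2 * (d * C) - n) ^ 2 ≤ r ^ 2 := sq_le_sq' hl hu
  -- Complete the square: `4 d (n - d C) C = n² - (2 d C - n)²`.
  have h₂ : B ^ 2 ≤ (n - d * C) * C := by
    refine le_of_mul_le_mul_left (a := 4 * d) ?_ (by positivity)
    linarith
  have h₃ : |2 * (d * C) - n| ≤ n := by
    apply abs_le_of_sq_le_sq _ hn.le
    nlinarith [sq_nonneg B]
  obtain ⟨h₄, h₅⟩ := abs_le.1 h₃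
  refine isSumFiveSqLinearForms_of_nonneg (by linarith) ?_ h₂
  refine nonneg_of_mul_nonneg_right (a := d) ?_ hd
  linarith

end QSqrt

namespace QSqrt

variable {D : ℕ}

theorem isSumOfFiveSquares_of_linearForms {R : Type*} [CommRing R] {A B C : ℤ}
    (h : IsSumFiveSqLinearForms A B C) (t : R) :
    IsSumOfFiveSquares (A + 2 * B * t + C * t ^ 2) := by
  obtain ⟨v, w, rfl, rfl, rfl⟩ := h
  refine ⟨fun i ↦ v i + w i * t, ?_⟩
  simp only [Fin.sum_univ_five]
  push_cast
  ring

theorem isSumOfFiveSquares_of_kappa_eq_two (hκ : kappa D = 2) {m : ℕ} (hD : 0 < D) (hm : 0 < m)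
    (hDm : D ≤ 2 * m) {x : 𝓞 (QSqrt D)} {u v : ℤ} (hx : 2 * x = kappa D * (u + v * sqrtInt D))
    (hu : 0 < u) (huv : D * v ^ 2 < u ^ 2) :
    IsSumOfFiveSquares ((kappa D : 𝓞 (QSqrt D)) * m * x) := by
  have hD' : (0 : ℤ) < D := by exact_mod_cast hD
  have hm' : (0 : ℤ) < m := by exact_mod_cast hm
  -- Comparing coefficients forces `A + D C = 2 m u` and `B = m v`. As `u² - D v² ≥ 1`, it suffices
  -- that `D C` lies within `m` of `m u`.
  obtain ⟨C, hl, hu'⟩ := exists_abs_sub_mul_le (r := m) (n := m * u) hD' (by exact_mod_cast hDm)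
  have hform := isSumFiveSqLinearForms_of_dist_le (n := 2 * m * u) (r := 2 * m) (B := m * v)
    (C := C) hD' (by positivity) (by linarith) (by linarith) (by
      have := mul_le_mul_of_nonneg_left (show 1 ≤ u ^ 2 - D * v ^ 2 by linarith) (sq_nonneg (m : ℤ))
      linarith)
  convert isSumOfFiveSquares_of_linearForms hform (sqrtInt D) using 1
  rw [hκ] at hx ⊢
  push_cast at hx ⊢
  linear_combination m * hx - (C : 𝓞 (QSqrt D)) * sqrtInt_sq D

theorem isSumOfFiveSquares_of_kappa_eq_one (hκ : kappa D = 1) {m : ℕ} (hD : 0 < D) (hm : 0 < m)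
    (hDm : D ≤ 2 * m) {x : 𝓞 (QSqrt D)} {u v : ℤ} (hx : 2 * x = kappa D * (u + v * sqrtInt D))
    (hev : Even (u - v)) (hu : 0 < u) (huv : D * v ^ 2 < u ^ 2) :
    IsSumOfFiveSquares ((kappa D : 𝓞 (QSqrt D)) * m * x) := by
  have hD' : (0 : ℤ) < D := by exact_mod_cast hD
  have hm' : (0 : ℤ) < m := by exact_mod_cast hm
  obtain ⟨e, he⟩ : ∃ e : ℤ, (D : ℤ) = 4 * e + 1 := by
    rcases kappa_cases D with ⟨h, -⟩ | ⟨-, h⟩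
    · exact ⟨D / 4, by omega⟩
    · omega
  obtain ⟨s, hs⟩ := even_iff_two_dvd.1 hev
  obtain rfl : u = 2 * s + v := by omega
  -- This positive integer is four times the norm of `x`, so it is at least `4`.
  have hN : 4 ≤ (2 * s + v) ^ 2 - D * v ^ 2 := by
    have : (2 * s + v) ^ 2 - D * v ^ 2 = 4 * (s ^ 2 + s * v - e * v ^ 2) := by rw [he]; ring
    omega
  -- For `t = (1 + √D) / 2`, `t² = t + e`, comparing coefficients forces `2 B + C = m v` and `A + e
  -- C = m s`. Thus `C` has prescribed parity and `D C` moves in steps of `2 D`, but the tolerance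
  -- is now `2 m`.
  obtain ⟨B, hl, hu'⟩ := exists_abs_sub_mul_le (d := 2 * D) (r := 2 * m)
    (n := D * (m * v) - m * (2 * s + v)) (by positivity) (by norm_cast; omega)
  obtain ⟨C, hC⟩ : ∃ C, C = m * v - 2 * B := ⟨_, rfl⟩
  obtain ⟨A, hA⟩ : ∃ A, A = m * s - e * C := ⟨_, rfl⟩
  have hdist : (D * C - m * (2 * s + v)) ^ 2 ≤ (2 * m : ℤ) ^ 2 := by
    apply sq_le_sq' <;> rw [hC] <;> linarith
  have hNm := mul_le_mul_of_nonneg_left hN (sq_nonneg (m : ℤ))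
  have hdisc : B ^ 2 ≤ A * C := by
    refine le_of_mul_le_mul_left (a := 4 * (D : ℤ)) ?_ (by positivity)
    have : 4 * D * (A * C) - 4 * D * B ^ 2 =
        m ^ 2 * ((2 * s + v) ^ 2 - D * v ^ 2) - (D * C - m * (2 * s + v)) ^ 2 := by
      rw [hA, hC, he]; ring
    linarith
  have habs : |D * C - m * (2 * s + v)| ≤ m * (2 * s + v) := by
    apply abs_le_of_sq_le_sq _ (by positivity)
    have : 0 ≤ (m : ℤ) ^ 2 * (D * v ^ 2) := by positivity
    linarith
  obtain ⟨h₁, h₂⟩ := abs_le.1 habs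
  have hC0 : 0 ≤ C := by
    refine nonneg_of_mul_nonneg_right (a := (D : ℤ)) ?_ hD'
    linarith
  have hA0 : 0 ≤ A := by
    rcases hC0.eq_or_lt with h | h
    · rw [← h, mul_zero] at hdisc
      have hB : B = 0 := pow_eq_zero_iff two_ne_zero |>.1 (le_antisymm hdisc (sq_nonneg B))
      have : 4 * A + 4 * B + C = 2 * m * (2 * s + v) - D * C := by rw [hA, hC, he]; ring
      rw [hB, ← h] at this
      have h₃ : 0 < (m : ℤ) * (2 * s + v) := by positivity
      linarith
    · exact nonneg_of_mul_nonneg_left ((sq_nonneg B).trans hdisc) h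
  obtain ⟨w, hw⟩ := exists_of_coords (D := D) (u := 1) (v := 1) (fun _ ↦ by simp)
  convert isSumOfFiveSquares_of_linearForms
    (isSumFiveSqLinearForms_of_nonneg hA0 hC0 hdisc) w using 1
  have h4 : (4 : 𝓞 (QSqrt D)) ≠ 0 := by norm_num
  apply mul_left_cancel₀ h4
  have he' : (D : 𝓞 (QSqrt D)) = 4 * e + 1 := by exact_mod_cast congrArg Int.cast he
  have hC' : (C : 𝓞 (QSqrt D)) = m * v - 2 * B := by exact_mod_cast congrArg Int.cast hC
  have hA' : (A : 𝓞 (QSqrt D)) = m * s - e * C := by exact_mod_cast congrArg Int.cast hA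
  rw [hκ] at hx hw ⊢
  push_cast at hx hw ⊢
  have hsq := sqrtInt_sq D
  rw [he'] at hsq
  linear_combination 2 * m * hx - (4 * B + C * (2 * w + 1 + sqrtInt D)) * hw - C * hsq - 4 * hA'
    - (2 + 2 * sqrtInt D) * hC'

end QSqrt

theorem theorem4 (D : ℕ) (hD : 2 ≤ D) (hsq : Squarefree D) (m : ℕ) (hm : 0 < m) :
    ((m : ℝ) < (kappa D : ℝ) * Real.sqrt (D : ℝ) / 4 →
      ¬ ∀ α ∈ totallyPositiveIntegers (QSqrt D), IsSumSq ((m : 𝓞 (QSqrt D)) * α)) ∧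
    ((D : ℝ) / 2 ≤ (m : ℝ) →
      ∀ α ∈ totallyPositiveIntegers (QSqrt D),
        IsSumOfFiveSquares ((kappa D : 𝓞 (QSqrt D)) * (m : 𝓞 (QSqrt D)) * α)) ∧
    (Odd m → D % 4 = 2 ∨ D % 4 = 3 →
      ∃ α ∈ totallyPositiveIntegers (QSqrt D), ¬ IsSumSq ((m : 𝓞 (QSqrt D)) * α)) := by
  refine ⟨fun h hall ↦ ?_, fun h α hα ↦ ?_, QSqrt.exists_not_isSumSq_of_odd hD hsq⟩
  · obtain ⟨α, hα, hn⟩ := QSqrt.exists_not_isSumSq_of_lt hD hsq hm h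
    exact hn (hall α hα)
  · have hDm : D ≤ 2 * m := by
      have : (D : ℝ) ≤ 2 * m := by linarith
      exact_mod_cast this
    obtain ⟨u, v, hx, hev⟩ := QSqrt.exists_coords hD hsq α
    obtain ⟨hu, huv⟩ := QSqrt.coords_of_mem_totallyPositive hD hsq hx hα
    rcases QSqrt.kappa_cases D with ⟨-, hκ⟩ | ⟨-, hκ⟩
    · exact QSqrt.isSumOfFiveSquares_of_kappa_eq_one hκ (by omega) hm hDm hx (hev hκ) hu huv
    · exact QSqrt.isSumOfFiveSquares_of_kappa_eq_two hκ (by omega) hm hDm hx hu huv
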